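/- For $n\in\mathbb{N}$ let $B_n$ be the Apéry polynomial $$B_n(z)=\sum_{k=0}^{n}\binom{n}{k}^2\binom{n+k}{k}^2 z^k .$$ Then for every $z\in\mathbb{C}\setminus(-\infty,0]$, $$B_n(z)\sim\frac{\left(1+\sqrt z+\sqrt{z+\sqrt z}\right)^2}{2\left(2\pi n\sqrt{z+\sqrt z}\right)^{3/2}}\left(1+2\sqrt z+2\sqrt{z+\sqrt z}\right)^{2n}\qquad\text{as } n\to\infty,$$ where all roots and fractional powers take their principal values on $\mathbb{C}\setminus(-\infty,0]$, i.e. $w^{\alpha}=\exp\{\alpha(\log|w|+i\arg w)\}$ with $\arg w\in(-\pi,\pi)$ (in particular $\sqrt w=w^{1/2}$), and $\sim$ means that the quotient of both sides converges to $1$. In particular, $$B_n(1)\sim\frac{(1+\sqrt2)^2}{(2\pi\sqrt2\,n)^{3/2}}\,(1+\sqrt2)^{4n}\qquad\text{as } n\to\infty .$$ -/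

import Mathlib

open Filter Asymptotics

/-- The Apéry polynomial `B_n(X) = ∑_{k=0}^n (n choose k)^2 (n+k choose k)^2 X^k`. -/
noncomputable def aperyPolynomial (n : ℕ) : Polynomial ℂ :=
  ∑ k ∈ Finset.range (n + 1),
    Polynomial.C (((n.choose k) ^ 2 * ((n + k).choose k) ^ 2 : ℕ) : ℂ) * Polynomial.X ^ k

open MeasureTheory Complex

open scoped Topology

/-! Put `s = √z`, so `0 < Re s`. By Fourier orthogonality, `B_n(s²)` is the mean over `θ` of `P_n(1
+ 2se^{iθ}) P_n(1 + 2se^{-iθ})`. Laplace's integral for each Legendre factor turns this into a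
triple integral of an `n`-th power (`integral_aperyPhase_pow`), and Laplace's method at the origin
applies (`tendsto_laplace`).

The main work is the global Gaussian bound `norm_aperyPhase_le`. The growth factor `p = |√t +
√(1+t)|` has inverse `|√(1+t) - √t|`, and `p² + p⁻² = 2(|t| + |1+t|)`. On the circle `|t| = |s|`
only `|1+t|` varies. For nonreal `s` one factor alone may exceed its value at `θ = 0`, but the
product over `se^{±iθ}` cannot, because `Re s > 0`.

The same reciprocal relation, without absolute values, gives the quadratic term of the phase
(`tendsto_mul_growth_sub`). It remains to identify the principal branches of the roots in the
Gaussian integral. -/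

/-! ### Legendre and Apéry polynomials as integrals -/

/-- Orthogonality of the exponentials `θ ↦ exp (i j θ)` on `(-π, π]`. -/
lemma integral_exp_pow_mul_exp_neg_pow (j k : ℕ) :
    ∫ θ in (-Real.pi)..Real.pi, exp ((θ : ℂ) * I) ^ j * exp (-((θ : ℂ) * I)) ^ k =
      if j = k then 2 * (Real.pi : ℂ) else 0 := by
  have h : ∀ θ : ℝ, exp ((θ : ℂ) * I) ^ j * exp (-((θ : ℂ) * I)) ^ k =
      exp ((((j : ℂ) - k) * I) * θ) := by
    intro θ
    rw [← exp_nat_mul, ← exp_nat_mul, ← exp_add]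
    congr 1
    ring
  simp_rw [h]
  split_ifs with hjk
  · subst hjk
    simp
    ring
  · have hc : ((j : ℂ) - k) * I ≠ 0 := by
      refine mul_ne_zero (sub_ne_zero.2 ?_) I_ne_zero
      exact_mod_cast hjk
    rw [integral_exp_mul_complex hc, div_eq_zero_iff]
    left
    rw [sub_eq_zero, exp_eq_exp_iff_exists_int]
    refine ⟨(j : ℤ) - k, ?_⟩
    push_cast
    ring

lemma integral_trigPoly_mul_trigPoly (n : ℕ) (a b : ℕ → ℂ) :
    ∫ θ in (-Real.pi)..Real.pi,
        (∑ j ∈ Finset.range (n + 1), a j * exp ((θ : ℂ) * I) ^ j) *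
          (∑ k ∈ Finset.range (n + 1), b k * exp (-((θ : ℂ) * I)) ^ k) =
      2 * (Real.pi : ℂ) * ∑ j ∈ Finset.range (n + 1), a j * b j := by
  simp_rw [Finset.sum_mul_sum]
  rw [intervalIntegral.integral_finsetSum
    fun j _ => Continuous.intervalIntegrable (by fun_prop) _ _, Finset.mul_sum]
  refine Finset.sum_congr rfl fun j hj => ?_
  rw [intervalIntegral.integral_finsetSum
    fun k _ => Continuous.intervalIntegrable (by fun_prop) _ _]
  have h : ∀ k, ∫ θ in (-Real.pi)..Real.pi,
      a j * exp ((θ : ℂ) * I) ^ j * (b k * exp (-((θ : ℂ) * I)) ^ k) =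
      if j = k then 2 * (Real.pi : ℂ) * (a j * b k) else 0 := by
    intro k
    have : ∀ θ : ℝ, a j * exp ((θ : ℂ) * I) ^ j * (b k * exp (-((θ : ℂ) * I)) ^ k) =
        (a j * b k) * (exp ((θ : ℂ) * I) ^ j * exp (-((θ : ℂ) * I)) ^ k) := fun θ => by ring
    simp_rw [this]
    rw [intervalIntegral.integral_const_mul, integral_exp_pow_mul_exp_neg_pow]
    split_ifs <;> ring
  simp_rw [h]
  rw [Finset.sum_ite_eq, if_pos hj]

/-- The Legendre polynomial `P_n(1 + 2t)`. -/
noncomputable def legendreShift (n : ℕ) (t : ℂ) : ℂ :=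
  ∑ k ∈ Finset.range (n + 1), ((n.choose k * (n + k).choose k : ℕ) : ℂ) * t ^ k

lemma sum_choose_mul_choose (n k : ℕ) :
    ∑ j ∈ Finset.range (k + 1), n.choose j * k.choose j = (n + k).choose k := by
  rw [Nat.add_choose_eq, Finset.Nat.sum_antidiagonal_eq_sum_range_succ_mk]
  refine Finset.sum_congr rfl fun j hj => ?_
  rw [Nat.choose_symm (by simpa [Nat.lt_succ_iff] using hj)]

/-- Expand `(1 + t)^(n - j)`, regroup by `C(n,j) C(n-j,k-j) = C(n,k) C(k,j)`, and sum over `j` by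
Vandermonde. -/
lemma sum_choose_sq_mul_pow (n : ℕ) (t : ℂ) :
    ∑ j ∈ Finset.range (n + 1), ((n.choose j : ℂ)) ^ 2 * (1 + t) ^ (n - j) * t ^ j =
      legendreShift n t := by
  have h1 : ∀ j ∈ Finset.range (n + 1),
      ((n.choose j : ℂ)) ^ 2 * (1 + t) ^ (n - j) * t ^ j =
      ∑ k ∈ Finset.range (n + 1),
        if j ≤ k then ((n.choose k * (n.choose j * k.choose j) : ℕ) : ℂ) * t ^ k else 0 := by
    intro j hj
    have hj' : j ≤ n := by simpa [Nat.lt_succ_iff] using hj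
    obtain ⟨m, rfl⟩ := Nat.exists_eq_add_of_le hj'
    rw [← Finset.sum_filter]
    have : (Finset.range (j + m + 1)).filter (fun k => j ≤ k) =
        (Finset.range (m + 1)).map (addLeftEmbedding j) := by
      ext k
      simp only [Finset.mem_filter, Finset.mem_range, Finset.mem_map, addLeftEmbedding_apply]
      constructor
      · rintro ⟨h, h'⟩
        exact ⟨k - j, by omega, by omega⟩
      · rintro ⟨a, h, rfl⟩
        omega
    rw [this, Finset.sum_map, Nat.add_sub_cancel_left, add_comm (1 : ℂ) t, add_pow,
      Finset.mul_sum, Finset.sum_mul]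
    refine Finset.sum_congr rfl fun i hi => ?_
    have hc := @Nat.choose_mul (j + m) (j + i) j (by omega)
    rw [Nat.add_sub_cancel_left, Nat.add_sub_cancel_left] at hc
    have hc' : (((j + m).choose (j + i) * (j + i).choose j : ℕ) : ℂ) =
      (((j + m).choose j * m.choose i : ℕ) : ℂ) := by rw [hc]
    push_cast at hc' ⊢
    simp only [addLeftEmbedding_apply, one_pow, mul_one, pow_add]
    linear_combination (-(t ^ j * t ^ i * ((j + m).choose j : ℂ))) * hc'
  rw [Finset.sum_congr rfl h1, Finset.sum_comm, legendreShift]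
  refine Finset.sum_congr rfl fun k hk => ?_
  rw [← Finset.sum_filter, ← Finset.sum_mul, ← Nat.cast_sum, ← Finset.mul_sum,
    ← sum_choose_mul_choose]
  have : (Finset.range (n + 1)).filter (fun j => j ≤ k) = Finset.range (k + 1) := by
    ext j
    simp only [Finset.mem_filter, Finset.mem_range] at hk ⊢
    omega
  rw [this]

/-- Laplace's integral for the Legendre polynomials. -/
lemma integral_laplace_legendre (n : ℕ) (x y : ℂ) (h : y ^ 2 = 1 + x ^ 2) :
    ∫ φ in (-Real.pi)..Real.pi, (1 + 2 * x ^ 2 + 2 * (x * y) * (Real.cos φ : ℂ)) ^ n =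
      2 * (Real.pi : ℂ) * legendreShift n (x ^ 2) := by
  -- Since `y² = 1 + x²`, the kernel factors as `(x e^{iφ} + y)(x e^{-iφ} + y)`, so orthogonality
  -- leaves the diagonal of two binomial expansions.
  have h1 : ∀ φ : ℝ, (1 + 2 * x ^ 2 + 2 * (x * y) * (Real.cos φ : ℂ)) ^ n =
      (∑ j ∈ Finset.range (n + 1), (n.choose j * x ^ j * y ^ (n - j)) * exp ((φ : ℂ) * I) ^ j) *
      (∑ j ∈ Finset.range (n + 1),
        (n.choose j * x ^ j * y ^ (n - j)) * exp (-((φ : ℂ) * I)) ^ j) := by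
    intro φ
    have hb : ∀ e : ℂ, ∑ j ∈ Finset.range (n + 1), (n.choose j * x ^ j * y ^ (n - j)) * e ^ j =
        (x * e + y) ^ n := by
      intro e
      rw [add_pow]
      refine Finset.sum_congr rfl fun j _ => ?_
      ring
    rw [hb, hb, ← mul_pow]
    congr 1
    have he : exp ((φ : ℂ) * I) * exp (-((φ : ℂ) * I)) = 1 := by
      rw [← exp_add]; simp
    have hc : 2 * (Real.cos φ : ℂ) = exp ((φ : ℂ) * I) + exp (-((φ : ℂ) * I)) := by
      rw [ofReal_cos, two_cos, neg_mul]
    linear_combination (x * y) * hc - x ^ 2 * he - h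
  simp_rw [h1]
  rw [integral_trigPoly_mul_trigPoly, ← sum_choose_sq_mul_pow, ← h]
  congr 1
  refine Finset.sum_congr rfl fun j _ => ?_
  ring

lemma integral_legendreShift_mul (n : ℕ) (s : ℂ) :
    ∫ θ in (-Real.pi)..Real.pi,
        legendreShift n (s * exp ((θ : ℂ) * I)) * legendreShift n (s * exp (-((θ : ℂ) * I))) =
      2 * (Real.pi : ℂ) * (aperyPolynomial n).eval (s ^ 2) := by
  simp only [legendreShift, mul_pow, ← mul_assoc]
  rw [integral_trigPoly_mul_trigPoly, aperyPolynomial, Polynomial.eval_finsetSum]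
  congr 1
  refine Finset.sum_congr rfl fun k _ => ?_
  simp only [Polynomial.eval_mul, Polynomial.eval_C, Polynomial.eval_pow, Polynomial.eval_X]
  push_cast
  ring

/-! ### Laplace's method in three variables -/

/-- The box `(-π, π]³`. -/
def piBox : Set (ℝ × ℝ × ℝ) :=
  Set.Ioc (-Real.pi) Real.pi ×ˢ (Set.Ioc (-Real.pi) Real.pi ×ˢ Set.Ioc (-Real.pi) Real.pi)

lemma measurableSet_piBox : MeasurableSet piBox :=
  measurableSet_Ioc.prod (measurableSet_Ioc.prod measurableSet_Ioc)

lemma piBox_mem_nhds_zero : piBox ∈ 𝓝 (0 : ℝ × ℝ × ℝ) := by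
  have h : Set.Ioc (-Real.pi) Real.pi ∈ 𝓝 (0 : ℝ) :=
    Ioc_mem_nhds (neg_lt_zero.2 Real.pi_pos) Real.pi_pos
  exact prod_mem_nhds h (prod_mem_nhds h h)

lemma tendsto_inv_sqrt_nat : Tendsto (fun n : ℕ => (√(n : ℝ))⁻¹) atTop (𝓝 0) :=
  tendsto_inv_atTop_zero.comp (Real.tendsto_sqrt_atTop.comp tendsto_natCast_atTop_atTop)

lemma tendsto_inv_sqrt_nat_smul (x : ℝ × ℝ × ℝ) :
    Tendsto (fun n : ℕ => (√(n : ℝ))⁻¹ • x) atTop (𝓝 0) := by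
  simpa using tendsto_inv_sqrt_nat.smul_const x

lemma norm_pow_le_gaussian {H : ℝ × ℝ × ℝ → ℂ} {c : ℝ}
    (hbd : ∀ x ∈ piBox, ‖H x‖ ≤ Real.exp (-c * (x.1 ^ 2 + x.2.1 ^ 2 + x.2.2 ^ 2)))
    {n : ℕ} (hn : n ≠ 0) {x : ℝ × ℝ × ℝ} (hx : (√(n : ℝ))⁻¹ • x ∈ piBox) :
    ‖H ((√(n : ℝ))⁻¹ • x) ^ n‖ ≤ Real.exp (-c * (x.1 ^ 2 + x.2.1 ^ 2 + x.2.2 ^ 2)) := by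
  rw [norm_pow]
  refine (pow_le_pow_left₀ (norm_nonneg _) (hbd _ hx) n).trans_eq ?_
  rw [← Real.exp_nat_mul]
  congr 1
  have hn' : (0 : ℝ) < n := by positivity
  simp only [Prod.smul_fst, Prod.smul_snd, smul_eq_mul, mul_pow, inv_pow, Real.sq_sqrt hn'.le]
  field_simp

lemma integrable_gaussian_prod {a b d : ℂ} (ha : 0 < a.re) (hb : 0 < b.re) (hd : 0 < d.re) :
    Integrable (fun x : ℝ × ℝ × ℝ => exp (-a * (x.1 : ℂ) ^ 2) *
      (exp (-b * (x.2.1 : ℂ) ^ 2) * exp (-d * (x.2.2 : ℂ) ^ 2))) :=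
  (integrable_cexp_neg_mul_sq ha).mul_prod
    ((integrable_cexp_neg_mul_sq hb).mul_prod (integrable_cexp_neg_mul_sq hd))

lemma integral_gaussian_prod {a b : ℂ} (ha : 0 < a.re) (hb : 0 < b.re) :
    ∫ x : ℝ × ℝ × ℝ, exp (-(a * (x.1 : ℂ) ^ 2 + b * ((x.2.1 : ℂ) ^ 2 + (x.2.2 : ℂ) ^ 2))) =
      (Real.pi / a) ^ (1 / 2 : ℂ) * (Real.pi / b) := by
  have h : ∀ x : ℝ × ℝ × ℝ,
      exp (-(a * (x.1 : ℂ) ^ 2 + b * ((x.2.1 : ℂ) ^ 2 + (x.2.2 : ℂ) ^ 2))) =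
      exp (-a * (x.1 : ℂ) ^ 2) * (exp (-b * (x.2.1 : ℂ) ^ 2) * exp (-b * (x.2.2 : ℂ) ^ 2)) := by
    intro x
    rw [← exp_add, ← exp_add]
    congr 1
    ring
  simp_rw [h]
  -- The two equal factors `(π/b)^(1/2)` multiply to `π/b`, so only the root of `π/a` carries a
  -- choice of branch.
  rw [Measure.volume_eq_prod,
    integral_prod_mul (fun x : ℝ => exp (-a * (x : ℂ) ^ 2))
      (fun y : ℝ × ℝ => exp (-b * (y.1 : ℂ) ^ 2) * exp (-b * (y.2 : ℂ) ^ 2)),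
    Measure.volume_eq_prod,
    integral_prod_mul (fun x : ℝ => exp (-b * (x : ℂ) ^ 2)) (fun x : ℝ => exp (-b * (x : ℂ) ^ 2)),
    integral_gaussian_complex ha, integral_gaussian_complex hb, ← sq, ← cpow_nat_mul]
  norm_num

/-- Laplace's method on the box `(-π, π]³` for a complex phase with a diagonal quadratic part. -/
lemma tendsto_laplace {H : ℝ × ℝ × ℝ → ℂ} (hm : Measurable H) {c : ℝ} (hc : 0 < c) {a b : ℂ}
    (hbd : ∀ x ∈ piBox, ‖H x‖ ≤ Real.exp (-c * (x.1 ^ 2 + x.2.1 ^ 2 + x.2.2 ^ 2)))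
    (hlim : ∀ x : ℝ × ℝ × ℝ, Tendsto (fun n : ℕ => (n : ℂ) * (H ((√(n : ℝ))⁻¹ • x) - 1)) atTop
      (𝓝 (-(a * (x.1 : ℂ) ^ 2 + b * ((x.2.1 : ℂ) ^ 2 + (x.2.2 : ℂ) ^ 2))))) :
    0 < a.re ∧ 0 < b.re ∧
      Tendsto (fun n : ℕ => ((√(n : ℝ) ^ 3 : ℝ) : ℂ) * ∫ x in piBox, H x ^ n) atTop
        (𝓝 ((Real.pi / a) ^ (1 / 2 : ℂ) * (Real.pi / b))) := by
  have hpow : ∀ x : ℝ × ℝ × ℝ, Tendsto (fun n : ℕ => H ((√(n : ℝ))⁻¹ • x) ^ n) atTop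
      (𝓝 (exp (-(a * (x.1 : ℂ) ^ 2 + b * ((x.2.1 : ℂ) ^ 2 + (x.2.2 : ℂ) ^ 2))))) := by
    intro x
    refine (tendsto_one_add_pow_exp_of_tendsto (hlim x)).congr fun n => ?_
    rw [add_sub_cancel]
  have hmem : ∀ x : ℝ × ℝ × ℝ, ∀ᶠ n : ℕ in atTop, (√(n : ℝ))⁻¹ • x ∈ piBox := fun x =>
    (tendsto_inv_sqrt_nat_smul x).eventually piBox_mem_nhds_zero
  have hle : ∀ x : ℝ × ℝ × ℝ,
      ‖exp (-(a * (x.1 : ℂ) ^ 2 + b * ((x.2.1 : ℂ) ^ 2 + (x.2.2 : ℂ) ^ 2)))‖ ≤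
        Real.exp (-c * (x.1 ^ 2 + x.2.1 ^ 2 + x.2.2 ^ 2)) := by
    intro x
    refine le_of_tendsto (hpow x).norm ?_
    filter_upwards [hmem x, eventually_ne_atTop 0] with n hn hn0
    exact norm_pow_le_gaussian hbd hn0 hn
  -- Positivity need not be assumed: the bound on `H` passes to the limiting Gaussian, and
  -- evaluating on an axis compares `Re a` with `c`.
  have hare : 0 < a.re := by
    have := hle (1, 0, 0)
    simp [norm_exp] at this
    linarith
  have hbre : 0 < b.re := by
    have := hle (0, 1, 0)
    simp [norm_exp] at this
    linarith
  refine ⟨hare, hbre, ?_⟩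
  have hscale : ∀ n : ℕ, n ≠ 0 → ∫ x, piBox.indicator (fun y => H y ^ n) ((√(n : ℝ))⁻¹ • x) =
      ((√(n : ℝ) ^ 3 : ℝ) : ℂ) * ∫ x in piBox, H x ^ n := by
    intro n hn
    have h2 : (volume : Measure (ℝ × ℝ)).IsAddHaarMeasure :=
      inferInstanceAs ((volume : Measure ℝ).prod (volume : Measure ℝ)).IsAddHaarMeasure
    have h3 : (volume : Measure (ℝ × ℝ × ℝ)).IsAddHaarMeasure :=
      inferInstanceAs ((volume : Measure ℝ).prod (volume : Measure (ℝ × ℝ))).IsAddHaarMeasure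
    rw [Measure.integral_comp_inv_smul, integral_indicator measurableSet_piBox,
      abs_of_nonneg (by positivity)]
    simp
  rw [← integral_gaussian_prod hare hbre]
  refine Tendsto.congr' ((eventually_ne_atTop 0).mono hscale) ?_
  refine tendsto_integral_filter_of_dominated_convergence
    (fun x : ℝ × ℝ × ℝ => Real.exp (-c * (x.1 ^ 2 + x.2.1 ^ 2 + x.2.2 ^ 2))) ?_ ?_ ?_ ?_
  · refine Eventually.of_forall fun n => Measurable.aestronglyMeasurable ?_
    exact ((hm.pow_const n).indicator measurableSet_piBox).comp (measurable_const_smul _)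
  · filter_upwards [eventually_ne_atTop 0] with n hn
    refine Eventually.of_forall fun x => ?_
    by_cases hx : (√(n : ℝ))⁻¹ • x ∈ piBox
    · rw [Set.indicator_of_mem hx]
      exact norm_pow_le_gaussian hbd hn hx
    · rw [Set.indicator_of_notMem hx, norm_zero]
      positivity
  · have h := (integrable_gaussian_prod (a := c) (b := c) (d := c)
      (by simpa) (by simpa) (by simpa)).norm
    refine h.congr (Eventually.of_forall fun x => ?_)
    simp only [norm_mul, norm_exp, ← Real.exp_add]
    congr 1
    norm_cast
    ring
  · refine Eventually.of_forall fun x => ?_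
    refine (hpow x).congr' ?_
    filter_upwards [hmem x] with n hn
    rw [Set.indicator_of_mem hn]

/-! ### Principal square roots and the growth factor -/

lemma Complex.sqrt_sq_self (z : ℂ) : sqrt z ^ 2 = z := by
  simp [sqrt]

lemma Complex.re_sqrt (z : ℂ) : (sqrt z).re = √((‖z‖ + z.re) / 2) := cpow_inv_two_re z

lemma Complex.re_sqrt_nonneg (z : ℂ) : 0 ≤ (sqrt z).re := by
  rw [re_sqrt]; positivity

lemma Complex.re_sqrt_pos {z : ℂ} (hz : z ∈ slitPlane) : 0 < (sqrt z).re := by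
  rw [re_sqrt]
  refine Real.sqrt_pos.2 (half_pos ?_)
  rcases hz with h | h
  · have := norm_nonneg z
    linarith
  · have := abs_re_lt_norm.2 h
    linarith [neg_abs_le z.re]

lemma Complex.im_sqrt_nonneg {z : ℂ} (hz : 0 ≤ z.im) : 0 ≤ (sqrt z).im := by
  rw [sqrt, cpow_inv_two_im_eq_sqrt hz]; positivity

lemma Complex.im_sqrt_nonpos {z : ℂ} (hz : z.im ≤ 0) (hz' : z ∈ slitPlane) :
    (sqrt z).im ≤ 0 := by
  have h : z.im = 2 * ((sqrt z).re * (sqrt z).im) := by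
    conv_lhs => rw [← sqrt_sq_self z]
    rw [sq, mul_im]; ring
  have := re_sqrt_pos hz'
  by_contra! h'
  have := mul_pos this h'
  linarith

/-- A square root with positive real part is the principal one. -/
lemma Complex.sqrt_eq_of_sq_eq {z w : ℂ} (h : w ^ 2 = z) (hw : 0 < w.re) : sqrt z = w := by
  have h2 : (sqrt z - w) * (sqrt z + w) = 0 := by
    linear_combination sqrt_sq_self z - h
  rcases mul_eq_zero.1 h2 with h3 | h3
  · exact sub_eq_zero.1 h3
  · have := congrArg re h3
    have h4 := re_sqrt_nonneg z
    simp at this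
    linarith

lemma Complex.norm_sqrt_sq (z : ℂ) : ‖sqrt z‖ ^ 2 = ‖z‖ := by
  rw [← norm_pow, sqrt_sq_self]

/-- The principal values of `√t` and `√(1 + t)` form an angle of at most `π / 2`. -/
lemma norm_sqrt_one_add_sub_le (t : ℂ) :
    ‖sqrt (1 + t) - sqrt t‖ ≤ ‖sqrt t + sqrt (1 + t)‖ := by
  have him : 0 ≤ (sqrt (1 + t)).im * (sqrt t).im := by
    rcases lt_trichotomy t.im 0 with h | h | h
    · exact mul_nonneg_of_nonpos_of_nonpos
        (im_sqrt_nonpos (by simpa using h.le) (Or.inr (by simpa using h.ne)))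
        (im_sqrt_nonpos h.le (Or.inr h.ne))
    · exact mul_nonneg (im_sqrt_nonneg (by simp [h])) (im_sqrt_nonneg h.ge)
    · exact mul_nonneg (im_sqrt_nonneg (by simpa using h.le)) (im_sqrt_nonneg h.le)
  have hre := mul_nonneg (re_sqrt_nonneg (1 + t)) (re_sqrt_nonneg t)
  rw [← sq_le_sq₀ (norm_nonneg _) (norm_nonneg _), ← normSq_eq_norm_sq, ← normSq_eq_norm_sq,
    normSq_apply, normSq_apply]
  simp only [sub_re, sub_im, add_re, add_im]
  nlinarith

/-- `|√t + √(1 + t)|`. -/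
noncomputable def halfGrowth (t : ℂ) : ℝ := ‖sqrt t + sqrt (1 + t)‖

lemma sqrt_add_mul_sqrt_sub (t : ℂ) :
    (sqrt t + sqrt (1 + t)) * (sqrt (1 + t) - sqrt t) = 1 := by
  linear_combination sqrt_sq_self (1 + t) - sqrt_sq_self t

lemma halfGrowth_mul_norm_sub (t : ℂ) : halfGrowth t * ‖sqrt (1 + t) - sqrt t‖ = 1 := by
  rw [halfGrowth, ← norm_mul, sqrt_add_mul_sqrt_sub, norm_one]

lemma one_le_halfGrowth (t : ℂ) : 1 ≤ halfGrowth t := by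
  have h1 := halfGrowth_mul_norm_sub t
  have h2 := norm_sqrt_one_add_sub_le t
  rw [← halfGrowth] at h2
  have h3 : 0 ≤ halfGrowth t := norm_nonneg _
  nlinarith [norm_nonneg (sqrt (1 + t) - sqrt t)]

lemma norm_sub_le_one (t : ℂ) : ‖sqrt (1 + t) - sqrt t‖ ≤ 1 := by
  have h1 := halfGrowth_mul_norm_sub t
  have h2 := one_le_halfGrowth t
  nlinarith [norm_nonneg (sqrt (1 + t) - sqrt t)]

/-- Parallelogram law for `√(1+t)` and `√t`. -/
lemma halfGrowth_sq_add (t : ℂ) :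
    halfGrowth t ^ 2 + ‖sqrt (1 + t) - sqrt t‖ ^ 2 = 2 * (‖t‖ + ‖1 + t‖) := by
  rw [halfGrowth, add_comm (sqrt t), ← norm_sqrt_sq t, ← norm_sqrt_sq (1 + t)]
  have := parallelogram_law_with_norm ℝ (sqrt (1 + t)) (sqrt t)
  nlinarith

/-- The larger root of `X + X⁻¹ = 2(|t| + |1+t|)`. This form shows continuity in `t` even across the
branch cuts. -/
lemma halfGrowth_sq_eq (t : ℂ) :
    halfGrowth t ^ 2 = (‖t‖ + ‖1 + t‖) + √((‖t‖ + ‖1 + t‖) ^ 2 - 1) := by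
  have h1 := halfGrowth_mul_norm_sub t
  have h2 := halfGrowth_sq_add t
  have h3 := norm_sqrt_one_add_sub_le t
  rw [← halfGrowth] at h3
  have h4 := norm_nonneg (sqrt (1 + t) - sqrt t)
  set p := halfGrowth t
  set k := ‖sqrt (1 + t) - sqrt t‖
  have h5 : ‖t‖ + ‖1 + t‖ = (p ^ 2 + k ^ 2) / 2 := by linarith
  have h6 : (‖t‖ + ‖1 + t‖) ^ 2 - 1 = ((p ^ 2 - k ^ 2) / 2) ^ 2 := by
    rw [h5]
    have : (p * k) ^ 2 = 1 := by rw [h1]; norm_num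
    linarith
  rw [h6, Real.sqrt_sq (by nlinarith), h5]
  ring

lemma one_lt_halfGrowth {s : ℂ} (hs : 0 < s.re) : 1 < halfGrowth s := by
  refine lt_of_le_of_ne (one_le_halfGrowth s) fun h => ?_
  have h1 := halfGrowth_mul_norm_sub s
  have h2 := halfGrowth_sq_add s
  rw [← h, one_mul] at h1
  rw [← h, h1] at h2
  have h3 : (1 + s).re ≤ ‖1 + s‖ := re_le_norm _
  have h4 := norm_nonneg s
  simp at h3
  linarith

/-- The integrand `1 + 2t + 2√(t(1+t)) cos φ` of Laplace's integral. -/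
noncomputable def laplaceKernel (t : ℂ) (φ : ℝ) : ℂ :=
  1 + 2 * t + 2 * (sqrt t * sqrt (1 + t)) * (Real.cos φ : ℂ)

lemma laplaceKernel_eq (t : ℂ) (φ : ℝ) :
    laplaceKernel t φ = (sqrt t + sqrt (1 + t)) ^ 2 -
      2 * (sqrt t * sqrt (1 + t)) * ((1 - Real.cos φ : ℝ) : ℂ) := by
  rw [laplaceKernel]
  push_cast
  linear_combination -sqrt_sq_self t - sqrt_sq_self (1 + t)

/-- The kernel is a convex combination of `(√(1+t) ± √t)²`, with weight `(1 - cos φ)/2` on the minus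
sign, where the modulus is at most `1`. -/
lemma norm_laplaceKernel_le (t : ℂ) (φ : ℝ) :
    ‖laplaceKernel t φ‖ ≤
      (1 - (1 - Real.cos φ) / 2) * halfGrowth t ^ 2 + (1 - Real.cos φ) / 2 := by
  have hc1 := Real.cos_le_one φ
  have hc2 := Real.neg_one_le_cos φ
  have h : laplaceKernel t φ =
      ((1 - (1 - Real.cos φ) / 2 : ℝ) : ℂ) * (sqrt t + sqrt (1 + t)) ^ 2 +
      (((1 - Real.cos φ) / 2 : ℝ) : ℂ) * (sqrt (1 + t) - sqrt t) ^ 2 := by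
    rw [laplaceKernel_eq]
    push_cast
    ring
  rw [h]
  refine (norm_add_le _ _).trans ?_
  rw [norm_mul, norm_mul, norm_pow, norm_pow, norm_real, norm_real,
    Real.norm_of_nonneg (by linarith), Real.norm_of_nonneg (by linarith), ← halfGrowth]
  have := norm_sub_le_one t
  have h1 : ‖sqrt (1 + t) - sqrt t‖ ^ 2 ≤ 1 := pow_le_one₀ (norm_nonneg _) this
  nlinarith

lemma norm_one_add_mul_exp_sq (s : ℂ) (θ : ℝ) :
    ‖1 + s * exp ((θ : ℂ) * I)‖ ^ 2 + ‖1 + s * exp (-((θ : ℂ) * I))‖ ^ 2 =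
      2 * ‖1 + s‖ ^ 2 - 4 * (s.re * (1 - Real.cos θ)) := by
  have h1 : exp ((θ : ℂ) * I) = ⟨Real.cos θ, Real.sin θ⟩ := by
    apply Complex.ext <;> simp [exp_ofReal_mul_I_re, exp_ofReal_mul_I_im]
  have h2 : exp (-((θ : ℂ) * I)) = ⟨Real.cos θ, -Real.sin θ⟩ := by
    have : -((θ : ℂ) * I) = ((-θ : ℝ) : ℂ) * I := by push_cast; ring
    rw [this]
    apply Complex.ext <;> simp only [exp_ofReal_mul_I_re, exp_ofReal_mul_I_im, Real.cos_neg,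
      Real.sin_neg]
  rw [h1, h2]
  simp only [← normSq_eq_norm_sq, normSq_apply, add_re, add_im, mul_re, mul_im, one_re, one_im]
  have := Real.sin_sq_add_cos_sq θ
  linear_combination (2 * (s.re ^ 2 + s.im ^ 2)) * this

lemma norm_mul_exp_I (s : ℂ) (θ : ℝ) : ‖s * exp ((θ : ℂ) * I)‖ = ‖s‖ := by
  rw [norm_mul, norm_exp_ofReal_mul_I, mul_one]

lemma norm_mul_exp_neg_I (s : ℂ) (θ : ℝ) : ‖s * exp (-((θ : ℂ) * I))‖ = ‖s‖ := by
  have : -((θ : ℂ) * I) = ((-θ : ℝ) : ℂ) * I := by push_cast; ring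
  rw [this, norm_mul_exp_I]

/-- Use `(a + b)² ≤ 2(a² + b²)`, then `√(1 - x) ≤ 1 - x/2`. -/
lemma norm_one_add_add_le {s : ℂ} (hs : 0 < s.re) (θ : ℝ) :
    ‖1 + s * exp ((θ : ℂ) * I)‖ + ‖1 + s * exp (-((θ : ℂ) * I))‖ ≤
      2 * ‖1 + s‖ - 2 * (s.re * (1 - Real.cos θ)) / ‖1 + s‖ := by
  have h := norm_one_add_mul_exp_sq s θ
  set a := ‖1 + s * exp ((θ : ℂ) * I)‖
  set b := ‖1 + s * exp (-((θ : ℂ) * I))‖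
  have h3 : (1 + s).re ≤ ‖1 + s‖ := re_le_norm _
  simp at h3
  set c := ‖1 + s‖
  have hc : 0 < c := by linarith
  have hc1 := Real.cos_le_one θ
  have hc2 := Real.neg_one_le_cos θ
  set D := s.re * (1 - Real.cos θ) with hD
  have hD0 : 0 ≤ D := mul_nonneg hs.le (by linarith)
  have hD1 : D ≤ c ^ 2 := by nlinarith
  have e : 2 * c - 2 * D / c = 2 * (c ^ 2 - D) / c := by field_simp
  rw [e]
  refine abs_le_of_sq_le_sq' ?_ (div_nonneg (by linarith) hc.le) |>.2
  rw [div_pow, le_div_iff₀ (by positivity)]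
  have h4 : (a + b) ^ 2 ≤ 4 * c ^ 2 - 8 * D := by nlinarith [sq_nonneg (a - b)]
  have h5 := mul_le_mul_of_nonneg_right h4 (sq_nonneg c)
  nlinarith [sq_nonneg D]

/-- `x + x⁻¹` increases on `[1, ∞)`, so `N ≤ M`; then `M⁻¹ ≤ N⁻¹` and the inverses can be dropped.
-/
lemma le_sub_of_add_inv_le {N M δ : ℝ} (hN : 1 ≤ N) (hM : 1 < M) (hδ : 0 ≤ δ)
    (h : N + N⁻¹ ≤ M + M⁻¹ - δ) : N ≤ M - δ := by
  have hNpos : 0 < N := by linarith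
  have hMpos : 0 < M := by linarith
  have hle : N ≤ M := by
    by_contra! hlt
    have h1 : M⁻¹ - N⁻¹ = (N - M) * (M⁻¹ * N⁻¹) := by field_simp
    have h2 : M⁻¹ * N⁻¹ < 1 := mul_lt_one_of_nonneg_of_lt_one_left (by positivity)
      (inv_lt_one_of_one_lt₀ hM) (inv_le_one_of_one_le₀ hN)
    have h3 := mul_lt_mul_of_pos_left h2 (sub_pos.2 hlt)
    linarith
  have := inv_anti₀ hNpos hle
  linarith

lemma halfGrowth_mul_le {s : ℂ} (hs : 0 < s.re) (θ : ℝ) :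
    halfGrowth (s * exp ((θ : ℂ) * I)) * halfGrowth (s * exp (-((θ : ℂ) * I))) ≤
      halfGrowth s ^ 2 - 2 * (s.re * (1 - Real.cos θ)) / ‖1 + s‖ := by
  have hab := norm_one_add_add_le hs θ
  have hδ : 0 ≤ 2 * (s.re * (1 - Real.cos θ)) / ‖1 + s‖ :=
    div_nonneg (mul_nonneg two_pos.le (mul_nonneg hs.le (by linarith [Real.cos_le_one θ])))
      (norm_nonneg _)
  set δ := 2 * (s.re * (1 - Real.cos θ)) / ‖1 + s‖
  set t := s * exp ((θ : ℂ) * I) with ht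
  set t' := s * exp (-((θ : ℂ) * I)) with ht'
  have n1 : ‖t‖ = ‖s‖ := norm_mul_exp_I s θ
  have n2 : ‖t'‖ = ‖s‖ := norm_mul_exp_neg_I s θ
  have q1 := halfGrowth_sq_add t
  have q2 := halfGrowth_sq_add t'
  have q0 := halfGrowth_sq_add s
  have m1 := halfGrowth_mul_norm_sub t
  have m2 := halfGrowth_mul_norm_sub t'
  have m0 := halfGrowth_mul_norm_sub s
  have l1 := one_le_halfGrowth t
  have l2 := one_le_halfGrowth t'
  have l0 := one_lt_halfGrowth hs
  set p := halfGrowth t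
  set p' := halfGrowth t'
  set p0 := halfGrowth s
  set k := ‖sqrt (1 + t) - sqrt t‖
  set k' := ‖sqrt (1 + t') - sqrt t'‖
  set k0 := ‖sqrt (1 + s) - sqrt s‖
  -- AM-GM on `pp'` and `kk'` reduces to the sum of squares, which the circle estimate controls.
  -- Since `kk'` is the inverse of `pp'`, the preceding lemma applies.
  have hN : p * p' + k * k' ≤ p0 ^ 2 + k0 ^ 2 - δ := by
    have u1 := two_mul_le_add_sq p p'
    have u2 := two_mul_le_add_sq k k'
    linarith
  have hN1 : 1 ≤ p * p' := by nlinarith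
  have hM1 : 1 < p0 ^ 2 := by nlinarith
  have e1 : (p * p') * (k * k') = 1 := by
    calc (p * p') * (k * k') = (p * k) * (p' * k') := by ring
      _ = 1 := by rw [m1, m2, one_mul]
  have e0 : p0 ^ 2 * k0 ^ 2 = 1 := by rw [← mul_pow, m0, one_pow]
  set N := p * p'
  set M := p0 ^ 2
  have e1' : k * k' = N⁻¹ := by
    rw [eq_inv_of_mul_eq_one_right e1]
  have e0' : k0 ^ 2 = M⁻¹ := by
    rw [eq_inv_of_mul_eq_one_right e0]
  rw [e1', e0'] at hN
  exact le_sub_of_add_inv_le hN1 hM1 hδ hN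

lemma halfGrowth_sq_mul_sq_le {s : ℂ} (hs : 0 < s.re) :
    ∃ c > 0, ∀ θ : ℝ,
      halfGrowth (s * exp ((θ : ℂ) * I)) ^ 2 * halfGrowth (s * exp (-((θ : ℂ) * I))) ^ 2 ≤
        halfGrowth s ^ 4 * (1 - c * ((1 - Real.cos θ) / 2)) := by
  have l0 := one_lt_halfGrowth hs
  have hc : 0 < ‖1 + s‖ := by
    have h3 : (1 + s).re ≤ ‖1 + s‖ := re_le_norm _
    simp at h3
    linarith
  -- One factor `pp'` is bounded by `p₀² - δ` and the other by `p₀²`; this constant is what `p₀²(p₀²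
  -- - δ)` gives, with `p₀ = halfGrowth s`.
  refine ⟨4 * s.re / (‖1 + s‖ * halfGrowth s ^ 2), by positivity, fun θ => ?_⟩
  have h := halfGrowth_mul_le hs θ
  have hN : 0 ≤ halfGrowth (s * exp ((θ : ℂ) * I)) * halfGrowth (s * exp (-((θ : ℂ) * I))) :=
    mul_nonneg (norm_nonneg _) (norm_nonneg _)
  have hδ : 0 ≤ 2 * (s.re * (1 - Real.cos θ)) / ‖1 + s‖ :=
    div_nonneg (mul_nonneg two_pos.le (mul_nonneg hs.le (by linarith [Real.cos_le_one θ])))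
      (norm_nonneg _)
  rw [← mul_pow]
  have e : halfGrowth s ^ 4 *
      (1 - 4 * s.re / (‖1 + s‖ * halfGrowth s ^ 2) * ((1 - Real.cos θ) / 2)) =
      halfGrowth s ^ 2 * (halfGrowth s ^ 2 - 2 * (s.re * (1 - Real.cos θ)) / ‖1 + s‖) := by
    have : halfGrowth s ≠ 0 := by positivity
    field_simp
    ring
  rw [e, sq (_ * _)]
  exact mul_le_mul (by linarith) h hN (by positivity)

/-- The other growth factor is at least `1`, so the product bound controls a single one, strictly
when `cos θ < 1`; if `cos θ = 1`, use `p₀² < p₀⁴`. Compactness makes the gap uniform. -/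
lemma exists_halfGrowth_sq_le {s : ℂ} (hs : 0 < s.re) :
    ∃ c > 0, ∀ θ ∈ Set.Icc (-Real.pi) Real.pi,
      halfGrowth (s * exp ((θ : ℂ) * I)) ^ 2 ≤ halfGrowth s ^ 4 * (1 - c) := by
  have l0 := one_lt_halfGrowth hs
  obtain ⟨d, hd, hprod⟩ := halfGrowth_sq_mul_sq_le hs
  have hcont : Continuous fun θ : ℝ => halfGrowth (s * exp ((θ : ℂ) * I)) ^ 2 := by
    simp_rw [halfGrowth_sq_eq]
    fun_prop
  have hlt : ∀ θ : ℝ, halfGrowth (s * exp ((θ : ℂ) * I)) ^ 2 < halfGrowth s ^ 4 := by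
    intro θ
    rcases (Real.cos_le_one θ).lt_or_eq with h | h
    · refine lt_of_le_of_lt ?_ ((hprod θ).trans_lt ?_)
      · exact le_mul_of_one_le_right (sq_nonneg _) (one_le_pow₀ (one_le_halfGrowth _))
      · refine mul_lt_of_lt_one_right (by positivity) ?_
        have := mul_pos hd (half_pos (sub_pos.2 h))
        linarith
    · have hsin : Real.sin θ = 0 := by
        have := Real.sin_sq_add_cos_sq θ
        rw [h] at this
        nlinarith
      have he : exp ((θ : ℂ) * I) = 1 := by
        apply Complex.ext <;> simp [exp_ofReal_mul_I_re, exp_ofReal_mul_I_im, h, hsin]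
      rw [he, mul_one]
      exact pow_lt_pow_right₀ l0 (by norm_num)
  obtain ⟨θ₀, -, hmax⟩ := isCompact_Icc.exists_isMaxOn
    (Set.nonempty_Icc.2 (by linarith [Real.pi_pos] : -Real.pi ≤ Real.pi)) hcont.continuousOn
  have hp : 0 < halfGrowth s ^ 4 := by positivity
  refine ⟨1 - halfGrowth (s * exp ((θ₀ : ℂ) * I)) ^ 2 / halfGrowth s ^ 4, ?_, fun θ hθ => ?_⟩
  · exact sub_pos.2 ((div_lt_one hp).2 (hlt θ₀))
  · rw [sub_sub_cancel, mul_div_cancel₀ _ hp.ne']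
    exact hmax hθ

/-! ### Gaussian domination of the phase -/

/-- The normalised phase of the triple integral representing the Apéry polynomial. -/
noncomputable def aperyPhase (s : ℂ) (x : ℝ × ℝ × ℝ) : ℂ :=
  laplaceKernel (s * exp ((x.1 : ℂ) * I)) x.2.1 * laplaceKernel (s * exp (-((x.1 : ℂ) * I))) x.2.2 /
    (sqrt s + sqrt (1 + s)) ^ 4

lemma measurable_aperyPhase (s : ℂ) : Measurable (aperyPhase s) := by
  unfold aperyPhase laplaceKernel Complex.sqrt
  fun_prop

lemma sq_div_pi_sq_le {x : ℝ} (hx : x ∈ Set.Ioc (-Real.pi) Real.pi) :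
    x ^ 2 / Real.pi ^ 2 ≤ (1 - Real.cos x) / 2 := by
  have := Real.cos_le_one_sub_mul_cos_sq (abs_le.2 ⟨hx.1.le, hx.2⟩)
  have e : 2 / Real.pi ^ 2 * x ^ 2 = 2 * (x ^ 2 / Real.pi ^ 2) := by ring
  rw [e] at this
  linarith

/-- The left side is at most `1 - d + d(1-κ)(1-κ')(1-τ)`. A product of three numbers in `[0,1]` is
at most their mean, hence `d/3`. -/
lemma convex_combination_le {d κ κ' τ A B C D : ℝ} (hd : 0 ≤ d)
    (hκ : 0 ≤ κ) (hκ1 : κ ≤ 1) (hκ' : 0 ≤ κ') (hκ1' : κ' ≤ 1) (hτ : 0 ≤ τ) (hτ1 : τ ≤ 1)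
    (hA : A ≤ 1 - d * τ) (hB : B ≤ 1 - d) (hC : C ≤ 1 - d) (hD : D ≤ 1 - d) :
    (1 - κ) * (1 - κ') * A + (1 - κ) * κ' * B + κ * (1 - κ') * C + κ * κ' * D ≤
      1 - d / 3 * (τ + κ + κ') := by
  have a1 := mul_le_mul_of_nonneg_left hA (mul_nonneg (sub_nonneg.2 hκ1) (sub_nonneg.2 hκ1'))
  have a2 := mul_le_mul_of_nonneg_left hB (mul_nonneg (sub_nonneg.2 hκ1) hκ')
  have a3 := mul_le_mul_of_nonneg_left hC (mul_nonneg hκ (sub_nonneg.2 hκ1'))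
  have a4 := mul_le_mul_of_nonneg_left hD (mul_nonneg hκ hκ')
  have u : 0 ≤ 1 - κ := sub_nonneg.2 hκ1
  have u' : 0 ≤ 1 - κ' := sub_nonneg.2 hκ1'
  have v : 0 ≤ 1 - τ := sub_nonneg.2 hτ1
  have b1 : (1 - κ) * (1 - κ') * (1 - τ) ≤ 1 - κ := by
    rw [mul_assoc]
    exact mul_le_of_le_one_right u (mul_le_one₀ (by linarith) v (by linarith))
  have b2 : (1 - κ) * (1 - κ') * (1 - τ) ≤ 1 - κ' := by
    rw [mul_right_comm]
    exact mul_le_of_le_one_left u' (mul_le_one₀ (by linarith) v (by linarith))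
  have b3 : (1 - κ) * (1 - κ') * (1 - τ) ≤ 1 - τ :=
    mul_le_of_le_one_left v (mul_le_one₀ (by linarith) u' (by linarith))
  have b : (1 - κ) * (1 - κ') * (1 - τ) ≤ 1 - (τ + κ + κ') / 3 := by linarith
  have := mul_le_mul_of_nonneg_left b hd
  nlinarith

lemma norm_aperyPhase_le {s : ℂ} (hs : 0 < s.re) :
    ∃ c > 0, ∀ x ∈ piBox,
      ‖aperyPhase s x‖ ≤ Real.exp (-c * (x.1 ^ 2 + x.2.1 ^ 2 + x.2.2 ^ 2)) := by
  obtain ⟨c₁, hc₁, h₁⟩ := halfGrowth_sq_mul_sq_le hs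
  obtain ⟨c₂, hc₂, h₂⟩ := exists_halfGrowth_sq_le hs
  have l0 := one_lt_halfGrowth hs
  have hM : 0 < halfGrowth s ^ 4 := by positivity
  have hd : 0 < min c₁ c₂ := lt_min hc₁ hc₂
  refine ⟨min c₁ c₂ / (3 * Real.pi ^ 2), by positivity, ?_⟩
  rintro ⟨θ, φ, ψ⟩ ⟨hθ, hφ, hψ⟩
  simp only at hθ hφ hψ
  have hA := h₁ θ
  have hB := h₂ θ ⟨hθ.1.le, hθ.2⟩
  -- The half-open interval is not symmetric, so the bound is needed at `-π` too.
  have hC := h₂ (-θ) ⟨by linarith [hθ.2], by linarith [hθ.1]⟩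
  rw [ofReal_neg, neg_mul] at hC
  have k1 := norm_laplaceKernel_le (s * exp ((θ : ℂ) * I)) φ
  have k2 := norm_laplaceKernel_le (s * exp (-((θ : ℂ) * I))) ψ
  have p1 : 1 ≤ halfGrowth (s * exp ((θ : ℂ) * I)) ^ 2 := one_le_pow₀ (one_le_halfGrowth _)
  have e1 := sq_div_pi_sq_le hθ
  have e2 := sq_div_pi_sq_le hφ
  have e3 := sq_div_pi_sq_le hψ
  have g : ∀ y : ℝ, 0 ≤ (1 - Real.cos y) / 2 ∧ (1 - Real.cos y) / 2 ≤ 1 := fun y =>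
    ⟨by linarith [Real.cos_le_one y], by linarith [Real.neg_one_le_cos y]⟩
  set P := halfGrowth (s * exp ((θ : ℂ) * I)) ^ 2
  set P' := halfGrowth (s * exp (-((θ : ℂ) * I))) ^ 2
  set M := halfGrowth s ^ 4
  obtain ⟨t0, t1⟩ := g θ
  obtain ⟨f0, f1⟩ := g φ
  obtain ⟨s0, s1⟩ := g ψ
  set τ := (1 - Real.cos θ) / 2
  set κ := (1 - Real.cos φ) / 2
  set κ' := (1 - Real.cos ψ) / 2
  have hnorm : ‖aperyPhase s (θ, φ, ψ)‖ ≤ ((1 - κ) * P + κ) * ((1 - κ') * P' + κ') / M := by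
    rw [aperyPhase, norm_div, norm_mul, norm_pow]
    exact div_le_div_of_nonneg_right
      (mul_le_mul k1 k2 (norm_nonneg _) ((norm_nonneg _).trans k1)) hM.le
  have hm1 : min c₁ c₂ ≤ c₁ := min_le_left _ _
  have hm2 : min c₁ c₂ ≤ c₂ := min_le_right _ _
  have hcomb := convex_combination_le (d := min c₁ c₂) (A := P * P' / M) (B := P / M)
    (C := P' / M) (D := 1 / M) hd.le f0 f1 s0 s1 t0 t1
    (by rw [div_le_iff₀' hM]; exact hA.trans (by gcongr))
    (by rw [div_le_iff₀' hM]; exact hB.trans (by gcongr))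
    (by rw [div_le_iff₀' hM]; exact hC.trans (by gcongr))
    (by rw [div_le_iff₀' hM]; exact (p1.trans hB).trans (by gcongr))
  calc ‖aperyPhase s (θ, φ, ψ)‖ ≤ ((1 - κ) * P + κ) * ((1 - κ') * P' + κ') / M := hnorm
    _ = (1 - κ) * (1 - κ') * (P * P' / M) + (1 - κ) * κ' * (P / M) + κ * (1 - κ') * (P' / M) +
        κ * κ' * (1 / M) := by ring
    _ ≤ 1 - min c₁ c₂ / 3 * (τ + κ + κ') := hcomb
    _ ≤ Real.exp (-(min c₁ c₂ / 3 * (τ + κ + κ'))) := Real.one_sub_le_exp_neg _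
    _ ≤ Real.exp (-(min c₁ c₂ / 3 *
          (θ ^ 2 / Real.pi ^ 2 + φ ^ 2 / Real.pi ^ 2 + ψ ^ 2 / Real.pi ^ 2))) := by gcongr
    _ = Real.exp (-(min c₁ c₂ / (3 * Real.pi ^ 2)) * (θ ^ 2 + φ ^ 2 + ψ ^ 2)) := by
        congr 1
        field_simp

/-! ### Second-order expansion at the origin -/

lemma tendsto_nat_mul_one_sub_cos (x : ℝ) :
    Tendsto (fun n : ℕ => (n : ℝ) * (1 - Real.cos ((√(n : ℝ))⁻¹ * x))) atTop (𝓝 (x ^ 2 / 2)) := by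
  have h0 : Tendsto (fun n : ℕ => (√(n : ℝ))⁻¹ * x / 2) atTop (𝓝 0) := by
    simpa using (tendsto_inv_sqrt_nat.mul_const x).div_const 2
  have h1 : Tendsto (fun n : ℕ => x ^ 2 / 2 * Real.sinc ((√(n : ℝ))⁻¹ * x / 2) ^ 2) atTop
      (𝓝 (x ^ 2 / 2)) := by
    have := (((Real.continuous_sinc.tendsto 0).comp h0).pow 2).const_mul (x ^ 2 / 2)
    simpa using this
  refine h1.congr' ?_
  filter_upwards [eventually_ne_atTop 0] with n hn
  have hn' : (0 : ℝ) < n := by positivity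
  have hsinc : ∀ y : ℝ, Real.sin y = y * Real.sinc y := by
    intro y
    rcases eq_or_ne y 0 with rfl | hy
    · simp
    · rw [Real.sinc_of_ne_zero hy]
      field_simp
  have hcos : 1 - Real.cos ((√(n : ℝ))⁻¹ * x) = 2 * Real.sin ((√(n : ℝ))⁻¹ * x / 2) ^ 2 := by
    have := Real.cos_sq_add_sin_sq ((√(n : ℝ))⁻¹ * x / 2)
    have h2 := Real.cos_two_mul ((√(n : ℝ))⁻¹ * x / 2)
    rw [mul_div_cancel₀ _ two_ne_zero] at h2
    linarith
  rw [hcos, hsinc, mul_pow, div_pow, mul_pow, inv_pow, Real.sq_sqrt hn'.le]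
  field_simp

lemma tendsto_natCast_mul_one_sub_cos (x : ℝ) :
    Tendsto (fun n : ℕ => (n : ℂ) * ((1 - Real.cos ((√(n : ℝ))⁻¹ * x) : ℝ) : ℂ)) atTop
      (𝓝 ((x : ℂ) ^ 2 / 2)) := by
  have := (continuous_ofReal.tendsto _).comp (tendsto_nat_mul_one_sub_cos x)
  simpa [Function.comp_def] using this

lemma mem_slitPlane_one_add {s : ℂ} (hs : 0 < s.re) : 1 + s ∈ slitPlane :=
  Or.inl (by simp only [add_re, one_re]; linarith)

lemma sqrt_add_sqrt_ne_zero (s : ℂ) : sqrt s + sqrt (1 + s) ≠ 0 :=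
  left_ne_zero_of_mul_eq_one (sqrt_add_mul_sqrt_sub s)

/-- If two sequences tend to `s` and their termwise product is `s²`, the product of the growth
factors deviates from its limit linearly in the deviation of their sum from `2s`. -/
lemma tendsto_mul_growth_sub {s : ℂ} (hs : 0 < s.re) {t t' : ℕ → ℂ} {m : ℕ → ℂ} {ℓ : ℂ}
    (ht : Tendsto t atTop (𝓝 s)) (ht' : Tendsto t' atTop (𝓝 s)) (hmul : ∀ n, t n * t' n = s ^ 2)
    (hm : Tendsto (fun n => m n * (2 * s - t n - t' n)) atTop (𝓝 ℓ)) :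
    Tendsto (fun n => m n * ((sqrt (t n) + sqrt (1 + t n)) * (sqrt (t' n) + sqrt (1 + t' n)) -
        (sqrt s + sqrt (1 + s)) ^ 2)) atTop
      (𝓝 (-ℓ * (sqrt s + sqrt (1 + s)) ^ 2 / (4 * (sqrt s * sqrt (1 + s)) * (1 + s)))) := by
  have hs0 := ne_zero_of_re_pos hs
  have hs1 : 1 + s ≠ 0 := slitPlane_ne_zero (mem_slitPlane_one_add hs)
  have c1 : ContinuousAt sqrt s := continuousAt_sqrt (Or.inl hs.le)
  have c2 : ContinuousAt sqrt (1 + s) :=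
    continuousAt_sqrt (Or.inl (by simp only [add_re, one_re]; linarith))
  have x1 : Tendsto (fun n => sqrt (t n)) atTop (𝓝 (sqrt s)) := c1.tendsto.comp ht
  have x2 : Tendsto (fun n => sqrt (t' n)) atTop (𝓝 (sqrt s)) := c1.tendsto.comp ht'
  have y1 : Tendsto (fun n => sqrt (1 + t n)) atTop (𝓝 (sqrt (1 + s))) :=
    c2.tendsto.comp (ht.const_add 1)
  have y2 : Tendsto (fun n => sqrt (1 + t' n)) atTop (𝓝 (sqrt (1 + s))) :=
    c2.tendsto.comp (ht'.const_add 1)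
  have q1 := sqrt_sq_self s
  have q2 := sqrt_sq_self (1 + s)
  have hx0 : sqrt s ≠ 0 := fun h => hs0 (by rw [← q1, h]; ring)
  have hy0 : sqrt (1 + s) ≠ 0 := fun h => hs1 (by rw [← q2, h]; ring)
  have hu0 := sqrt_add_sqrt_ne_zero s
  have hW := (x1.add y1).mul (x2.add y2)
  have hX := y1.mul y2
  have hxx := (x1.mul x2).add_const s
  set u := sqrt s + sqrt (1 + s) with hu
  have hU : u * u * u ^ 2 - 1 = 4 * (sqrt s * sqrt (1 + s)) * u ^ 2 := by
    rw [hu]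
    linear_combination (sqrt (1 + s) ^ 2 - sqrt s ^ 2 + 1) * (q2 - q1)
  have hUne : u * u * u ^ 2 - 1 ≠ 0 := by
    rw [hU]
    exact mul_ne_zero (mul_ne_zero (by norm_num) (mul_ne_zero hx0 hy0)) (pow_ne_zero 2 hu0)
  have hXne : sqrt (1 + s) * sqrt (1 + s) + (1 + s) ≠ 0 := by
    rw [← sq, q2, ← two_mul]
    exact mul_ne_zero two_ne_zero hs1
  have hD := (((hW.mul_const (u ^ 2)).sub_const 1).mul (hX.add_const (1 + s)))
  have hlim := (((hm.const_mul (-2)).mul (hW.mul_const (u ^ 2))).div hD (mul_ne_zero hUne hXne))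
  have hval : -2 * ℓ * (u * u * u ^ 2) /
      ((u * u * u ^ 2 - 1) * (sqrt (1 + s) * sqrt (1 + s) + (1 + s))) =
      -ℓ * u ^ 2 / (4 * (sqrt s * sqrt (1 + s)) * (1 + s)) := by
    rw [hU, ← sq (sqrt (1 + s)), q2]
    field_simp
    ring
  rw [hval] at hlim
  refine hlim.congr' ?_
  have hxxne : sqrt s * sqrt s + s ≠ 0 := by
    rw [← sq, q1, ← two_mul]
    exact mul_ne_zero two_ne_zero hs0
  filter_upwards [hxx.eventually_ne hxxne, hD.eventually_ne (mul_ne_zero hUne hXne)] with n h1 h2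
  -- The product squares to `s²`, and its sum with `s` is near `2s ≠ 0`, which excludes the sign
  -- `-s`.
  have hroot : sqrt (t n) * sqrt (t' n) = s := by
    have : (sqrt (t n) * sqrt (t' n) - s) * (sqrt (t n) * sqrt (t' n) + s) = 0 := by
      have e : sqrt (t n) ^ 2 * sqrt (t' n) ^ 2 = s ^ 2 := by
        rw [sqrt_sq_self, sqrt_sq_self, hmul n]
      linear_combination e
    exact sub_eq_zero.1 ((mul_eq_zero.1 this).resolve_right h1)
  rw [Pi.div_apply, div_eq_iff h2]
  have b1 := sqrt_sq_self (1 + t n)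
  have b2 := sqrt_sq_self (1 + t' n)
  have k1 := sqrt_add_mul_sqrt_sub (t n)
  have k2 := sqrt_add_mul_sqrt_sub (t' n)
  have k0 := sqrt_add_mul_sqrt_sub s
  have hm' := hmul n
  set x := sqrt (t n)
  set x' := sqrt (t' n)
  set y := sqrt (1 + t n)
  set y' := sqrt (1 + t' n)
  have hXX : (y * y' - (1 + s)) * (y * y' + (1 + s)) = t n + t' n - 2 * s := by
    have e : y ^ 2 * y' ^ 2 = (1 + t n) * (1 + t' n) := by rw [b1, b2]
    linear_combination e + hm'
  have hWK : (x + y) * (x' + y') + (y - x) * (y' - x') = 2 * (s + y * y') := by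
    linear_combination 2 * hroot
  have hUK : u ^ 2 + (sqrt (1 + s) - sqrt s) ^ 2 = 2 * (s + (1 + s)) := by
    rw [hu]
    linear_combination 2 * q1 + 2 * q2
  have hKW : ((x + y) * (x' + y')) * ((y - x) * (y' - x')) = 1 := by
    calc _ = ((x + y) * (y - x)) * ((x' + y') * (y' - x')) := by ring
      _ = 1 := by rw [k1, k2, one_mul]
  have hKU : u ^ 2 * (sqrt (1 + s) - sqrt s) ^ 2 = 1 := by rw [← mul_pow, k0, one_pow]
  generalize (x + y) * (x' + y') = W at *
  generalize (y - x) * (y' - x') = K at *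
  generalize y * y' = X at *
  generalize (sqrt (1 + s) - sqrt s) ^ 2 = K₀ at *
  -- Subtract `W + W⁻¹ = 2(s + X)` and `u² + u⁻² = 2(s + 1 + s)`. With `hXX`, `W - u²` becomes an
  -- explicit multiple of `t + t' - 2s`, without derivatives.
  have key : (W - u ^ 2) * (W * u ^ 2 - 1) = 2 * (X - (1 + s)) * (W * u ^ 2) := by
    linear_combination (W * u ^ 2) * (hWK - hUK) - u ^ 2 * hKW + W * hKU
  linear_combination (-(m n) * (X + (1 + s))) * key - (2 * m n * (W * u ^ 2)) * hXX

/-- The second-order expansion of the phase at its maximum. -/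
lemma tendsto_aperyPhase {s : ℂ} (hs : 0 < s.re) (x : ℝ × ℝ × ℝ) :
    Tendsto (fun n : ℕ => (n : ℂ) * (aperyPhase s ((√(n : ℝ))⁻¹ • x) - 1)) atTop
      (𝓝 (-(s / (2 * (sqrt s * sqrt (1 + s)) * (1 + s)) * (x.1 : ℂ) ^ 2 +
        sqrt s * sqrt (1 + s) / (sqrt s + sqrt (1 + s)) ^ 2 *
          ((x.2.1 : ℂ) ^ 2 + (x.2.2 : ℂ) ^ 2)))) := by
  obtain ⟨a, b, d⟩ := x
  have hs0 := ne_zero_of_re_pos hs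
  have hs1 : 1 + s ≠ 0 := slitPlane_ne_zero (mem_slitPlane_one_add hs)
  set t : ℕ → ℂ := fun n => s * exp ((((√(n : ℝ))⁻¹ * a : ℝ) : ℂ) * I) with ht_def
  set t' : ℕ → ℂ := fun n => s * exp (-((((√(n : ℝ))⁻¹ * a : ℝ) : ℂ) * I)) with ht'_def
  have hθ : Tendsto (fun n : ℕ => (((√(n : ℝ))⁻¹ * a : ℝ) : ℂ) * I) atTop (𝓝 0) := by
    have := ((continuous_ofReal.tendsto _).comp (tendsto_inv_sqrt_nat.mul_const a)).mul_const I
    simpa [Function.comp_def] using this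
  have ht : Tendsto t atTop (𝓝 s) := by
    have := ((continuous_exp.tendsto _).comp hθ).const_mul s
    simpa [Function.comp_def, ht_def] using this
  have ht' : Tendsto t' atTop (𝓝 s) := by
    have := ((continuous_exp.tendsto _).comp hθ.neg).const_mul s
    simpa [Function.comp_def, ht'_def] using this
  have hmul : ∀ n, t n * t' n = s ^ 2 := by
    intro n
    simp only [ht_def, ht'_def]
    rw [mul_mul_mul_comm, ← exp_add, add_neg_cancel, exp_zero, mul_one, sq]
  have hm : Tendsto (fun n : ℕ => (n : ℂ) * (2 * s - t n - t' n)) atTop (𝓝 (s * (a : ℂ) ^ 2)) := by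
    have := (tendsto_natCast_mul_one_sub_cos a).const_mul (2 * s)
    have e : 2 * s * ((a : ℂ) ^ 2 / 2) = s * (a : ℂ) ^ 2 := by ring
    rw [e] at this
    refine this.congr fun n => ?_
    simp only [ht_def, ht'_def]
    have hc := two_cos (((√(n : ℝ))⁻¹ * a : ℝ) : ℂ)
    rw [neg_mul] at hc
    rw [ofReal_sub, ofReal_one, ofReal_cos]
    linear_combination (-(n : ℂ) * s) * hc
  have hW := tendsto_mul_growth_sub hs ht ht' hmul hm
  have c1 : ContinuousAt sqrt s := continuousAt_sqrt (Or.inl hs.le)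
  have c2 : ContinuousAt sqrt (1 + s) :=
    continuousAt_sqrt (Or.inl (by simp only [add_re, one_re]; linarith))
  have x1 : Tendsto (fun n => sqrt (t n)) atTop (𝓝 (sqrt s)) := c1.tendsto.comp ht
  have x2 : Tendsto (fun n => sqrt (t' n)) atTop (𝓝 (sqrt s)) := c1.tendsto.comp ht'
  have y1 : Tendsto (fun n => sqrt (1 + t n)) atTop (𝓝 (sqrt (1 + s))) :=
    c2.tendsto.comp (ht.const_add 1)
  have y2 : Tendsto (fun n => sqrt (1 + t' n)) atTop (𝓝 (sqrt (1 + s))) :=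
    c2.tendsto.comp (ht'.const_add 1)
  have q1 := sqrt_sq_self s
  have q2 := sqrt_sq_self (1 + s)
  have hx0 : sqrt s ≠ 0 := fun h => hs0 (by rw [← q1, h]; ring)
  have hy0 : sqrt (1 + s) ≠ 0 := fun h => hs1 (by rw [← q2, h]; ring)
  have hu0 := sqrt_add_sqrt_ne_zero s
  have u1 := x1.add y1
  have u2 := x2.add y2
  have g1 := x1.mul y1
  have g2 := x2.mul y2
  have f1 := tendsto_natCast_mul_one_sub_cos b
  have f2 := tendsto_natCast_mul_one_sub_cos d
  have f3 : Tendsto (fun n : ℕ => ((1 - Real.cos ((√(n : ℝ))⁻¹ * d) : ℝ) : ℂ)) atTop (𝓝 0) := by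
    have h0 := tendsto_inv_sqrt_nat.mul_const d
    have h1 := (Real.continuous_cos.tendsto _).comp h0
    have := (continuous_ofReal.tendsto _).comp (h1.const_sub 1)
    simpa [Function.comp_def] using this
  set u := sqrt s + sqrt (1 + s)
  set q := sqrt s * sqrt (1 + s)
  have hq0 : q ≠ 0 := mul_ne_zero hx0 hy0
  -- Write each kernel as its value at `φ = 0` minus a multiple of `1 - cos`. The product of the two
  -- cosine defects vanishes after scaling by `n`.
  have main := ((((hW.mul ((u1.mul u2).add_const (u ^ 2))).sub
    (((g1.const_mul 2).mul (u2.pow 2)).mul f1)).sub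
    (((g2.const_mul 2).mul (u1.pow 2)).mul f2)).add
    ((((g1.const_mul 2).mul (g2.const_mul 2)).mul f1).mul f3)).div_const (u ^ 4)
  refine (main.congr fun n => ?_).trans_eq ?_
  · simp only [aperyPhase, laplaceKernel_eq, Prod.smul_mk, smul_eq_mul]
    rw [div_sub_one (pow_ne_zero 4 hu0)]
    simp only [ht_def, ht'_def]
    ring
  · congr 1
    field_simp
    ring

/-! ### The triple integral -/

lemma integral_laplaceKernel_pow (n : ℕ) (t : ℂ) :
    ∫ φ in Set.Ioc (-Real.pi) Real.pi, laplaceKernel t φ ^ n =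
      2 * (Real.pi : ℂ) * legendreShift n t := by
  have h := integral_laplace_legendre n (sqrt t) (sqrt (1 + t))
    (by rw [sqrt_sq_self, sqrt_sq_self])
  rw [intervalIntegral.integral_of_le (by linarith [Real.pi_pos]), sqrt_sq_self] at h
  exact h

/-- The Apéry polynomial as a triple integral. -/
lemma integral_aperyPhase_pow {s : ℂ} (hs : 0 < s.re) (n : ℕ) :
    ∫ x in piBox, aperyPhase s x ^ n =
      (2 * (Real.pi : ℂ)) ^ 3 * (aperyPolynomial n).eval (s ^ 2) /
        ((sqrt s + sqrt (1 + s)) ^ 2) ^ (2 * n) := by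
  obtain ⟨c, hc, hbd⟩ := norm_aperyPhase_le hs
  have hfin : volume piBox ≠ ⊤ := by
    rw [piBox, Measure.volume_eq_prod, Measure.prod_prod, Measure.volume_eq_prod,
      Measure.prod_prod, Real.volume_Ioc]
    exact ENNReal.mul_ne_top ENNReal.ofReal_ne_top
      (ENNReal.mul_ne_top ENNReal.ofReal_ne_top ENNReal.ofReal_ne_top)
  -- The principal roots may jump across the cut, so integrability comes from measurability and the
  -- bound by `1`.
  have hintegrable : IntegrableOn (fun x => aperyPhase s x ^ n) piBox := by
    refine Measure.integrableOn_of_bounded (M := 1) hfin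
      ((measurable_aperyPhase s).pow_const n).aestronglyMeasurable ?_
    refine (ae_restrict_iff' measurableSet_piBox).2 (Eventually.of_forall fun x hx => ?_)
    rw [norm_pow]
    refine pow_le_one₀ (norm_nonneg _) ((hbd x hx).trans (Real.exp_le_one_iff.2 ?_))
    have : 0 ≤ x.1 ^ 2 + x.2.1 ^ 2 + x.2.2 ^ 2 := by positivity
    nlinarith
  have hinner : ∀ θ : ℝ,
      ∫ y in Set.Ioc (-Real.pi) Real.pi ×ˢ Set.Ioc (-Real.pi) Real.pi, aperyPhase s (θ, y) ^ n =
      (2 * (Real.pi : ℂ)) ^ 2 / ((sqrt s + sqrt (1 + s)) ^ 2) ^ (2 * n) *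
        (legendreShift n (s * exp ((θ : ℂ) * I)) * legendreShift n (s * exp (-((θ : ℂ) * I)))) := by
    intro θ
    have e : ∀ y : ℝ × ℝ, aperyPhase s (θ, y) ^ n =
        (((sqrt s + sqrt (1 + s)) ^ 2) ^ (2 * n))⁻¹ *
        (laplaceKernel (s * exp ((θ : ℂ) * I)) y.1 ^ n *
          laplaceKernel (s * exp (-((θ : ℂ) * I))) y.2 ^ n) := by
      intro y
      rw [aperyPhase, div_pow, mul_pow, ← pow_mul, ← pow_mul, show 2 * (2 * n) = 4 * n by ring,
        div_eq_inv_mul]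
    simp_rw [e]
    rw [integral_const_mul, Measure.volume_eq_prod,
      setIntegral_prod_mul (fun φ => laplaceKernel (s * exp ((θ : ℂ) * I)) φ ^ n)
        (fun φ => laplaceKernel (s * exp (-((θ : ℂ) * I))) φ ^ n),
      integral_laplaceKernel_pow, integral_laplaceKernel_pow]
    ring
  have hB := integral_legendreShift_mul n s
  rw [intervalIntegral.integral_of_le (by linarith [Real.pi_pos])] at hB
  rw [piBox, Measure.volume_eq_prod] at hintegrable ⊢
  rw [setIntegral_prod _ hintegrable]
  simp_rw [hinner]
  rw [integral_const_mul, hB]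
  ring

/-! ### Branches in the Gaussian constant -/

lemma abs_im_sqrt_lt_re {s : ℂ} (hs : 0 < s.re) : |(sqrt s).im| < (sqrt s).re := by
  have h : s.re = (sqrt s).re ^ 2 - (sqrt s).im ^ 2 := by
    conv_lhs => rw [← sqrt_sq_self s]
    rw [sq, mul_re]; ring
  have := re_sqrt_pos (Or.inl hs : s ∈ slitPlane)
  refine abs_lt_of_sq_lt_sq ?_ this.le
  linarith

/-- Both roots have argument in `(-π/4, π/4)`. -/
lemma re_sqrt_mul_sqrt_pos {s : ℂ} (hs : 0 < s.re) : 0 < (sqrt s * sqrt (1 + s)).re := by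
  have h1 := abs_im_sqrt_lt_re hs
  have h2 := abs_im_sqrt_lt_re (s := 1 + s) (by simp only [add_re, one_re]; linarith)
  have h3 := mul_lt_mul'' h1 h2 (abs_nonneg _) (abs_nonneg _)
  rw [← abs_mul] at h3
  rw [mul_re]
  linarith [le_abs_self ((sqrt s).im * (sqrt (1 + s)).im)]

/-- Numerator and denominator have positive real parts and lie weakly on the same side of the real
axis. -/
lemma re_one_add_div_sqrt_pos {s : ℂ} (hs : 0 < s.re) :
    0 < ((1 + s) / sqrt (sqrt s * sqrt (1 + s))).re := by
  have hq := re_sqrt_mul_sqrt_pos hs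
  have hs' : 0 < (1 + s).re := by simp only [add_re, one_re]; linarith
  have r1 := re_sqrt_pos (Or.inl hs : s ∈ slitPlane)
  have r2 := re_sqrt_pos (Or.inl hs' : 1 + s ∈ slitPlane)
  have rg := re_sqrt_pos (Or.inl hq : sqrt s * sqrt (1 + s) ∈ slitPlane)
  have him : 0 ≤ (1 + s).im * (sqrt (sqrt s * sqrt (1 + s))).im := by
    have e : (sqrt s * sqrt (1 + s)).im =
        (sqrt s).re * (sqrt (1 + s)).im + (sqrt s).im * (sqrt (1 + s)).re := mul_im _ _
    rcases le_total 0 s.im with h | h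
    · have h' : 0 ≤ (1 + s).im := by simpa using h
      refine mul_nonneg h' (im_sqrt_nonneg ?_)
      have i1 := im_sqrt_nonneg h
      have i2 := im_sqrt_nonneg h'
      rw [e]
      positivity
    · have h' : (1 + s).im ≤ 0 := by simpa using h
      refine mul_nonneg_of_nonpos_of_nonpos h' (im_sqrt_nonpos ?_ (Or.inl hq))
      have i1 := mul_nonpos_of_nonpos_of_nonneg (im_sqrt_nonpos h (Or.inl hs)) r2.le
      have i2 := mul_nonpos_of_nonneg_of_nonpos r1.le (im_sqrt_nonpos h' (Or.inl hs'))
      rw [e]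
      linarith
  have hg : sqrt (sqrt s * sqrt (1 + s)) ≠ 0 := ne_zero_of_re_pos rg
  have hn : 0 < normSq (sqrt (sqrt s * sqrt (1 + s))) := normSq_pos.2 hg
  rw [div_re, ← add_div]
  exact div_pos (add_pos_of_pos_of_nonneg (mul_pos hs' rg) him) hn

/-- With `q = √s √(1+s)` and `q² = s(1+s)`, the base is `2π(1+s)²/q`; the sign of the real part
selects the root. -/
lemma cpow_half_eq {s : ℂ} (hs : 0 < s.re) :
    ((Real.pi : ℂ) / (s / (2 * (sqrt s * sqrt (1 + s)) * (1 + s)))) ^ (1 / 2 : ℂ) =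
      (√(2 * Real.pi) : ℝ) * ((1 + s) / sqrt (sqrt s * sqrt (1 + s))) := by
  have hs0 := ne_zero_of_re_pos hs
  have hq0 := ne_zero_of_re_pos (re_sqrt_mul_sqrt_pos hs)
  have hq2 : (sqrt s * sqrt (1 + s)) ^ 2 = s * (1 + s) := by
    rw [mul_pow, sqrt_sq_self, sqrt_sq_self]
  rw [one_div]
  refine sqrt_eq_of_sq_eq ?_ ?_
  · rw [mul_pow, div_pow, sqrt_sq_self, ← ofReal_pow, Real.sq_sqrt (by positivity)]
    push_cast
    generalize sqrt s * sqrt (1 + s) = q at *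
    field_simp
    linear_combination -(1 + s) * hq2
  · rw [re_ofReal_mul]
    exact mul_pos (Real.sqrt_pos.2 (by positivity)) (re_one_add_div_sqrt_pos hs)

lemma cpow_three_halves_eq {q : ℂ} (hq : 0 < q.re) (n : ℕ) :
    (2 * (Real.pi : ℂ) * (n : ℂ) * q) ^ (3 / 2 : ℂ) =
      (√(2 * Real.pi) : ℝ) ^ 3 * (√(n : ℝ) : ℝ) ^ 3 * (q * sqrt q) := by
  have h1 : 2 * (Real.pi : ℂ) * (n : ℂ) = ((2 * Real.pi * n : ℝ) : ℂ) := by push_cast; ring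
  have h2 : (3 / 2 : ℂ) = ((3 / 2 : ℝ) : ℂ) := by push_cast; ring
  have h3 : (2 * Real.pi * n : ℝ) ^ (3 / 2 : ℝ) = √(2 * Real.pi) ^ 3 * √(n : ℝ) ^ 3 := by
    rw [← mul_pow, ← Real.sqrt_mul (by positivity), Real.sqrt_eq_rpow, ← Real.rpow_natCast,
      ← Real.rpow_mul (by positivity)]
    norm_num
  have h4 : q ^ (3 / 2 : ℂ) = q * sqrt q := by
    rw [sqrt, show (3 / 2 : ℂ) = 1 + 2⁻¹ by norm_num, cpow_add _ _ (ne_zero_of_re_pos hq), cpow_one]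
  have h5 : (((2 * Real.pi * n : ℝ) : ℂ) * q) ^ (3 / 2 : ℂ) =
      ((2 * Real.pi * n : ℝ) : ℂ) ^ (3 / 2 : ℂ) * q ^ (3 / 2 : ℂ) := by
    rcases n.eq_zero_or_pos with rfl | hn
    · have : (3 / 2 : ℂ) ≠ 0 := by norm_num
      simp [zero_cpow this]
    · have hpos : 0 < 2 * Real.pi * n := by positivity
      have hne := ofReal_ne_zero.2 hpos.ne'
      have hq0 := ne_zero_of_re_pos hq
      rw [cpow_def_of_ne_zero (mul_ne_zero hne hq0), cpow_def_of_ne_zero hne,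
        cpow_def_of_ne_zero hq0, log_ofReal_mul hpos hq0, ← exp_add, ← ofReal_log hpos.le, add_mul]
  rw [h1, h5, h4, h2, ← ofReal_cpow (by positivity), h3]
  push_cast
  ring

/-! ### Assembly -/

/-- The asymptotics of the Apéry polynomials at `s²`, where `0 < Re s`. -/
lemma isEquivalent_aperyPolynomial_sq {s : ℂ} (hs : 0 < s.re) :
    IsEquivalent atTop (fun n : ℕ => (aperyPolynomial n).eval (s ^ 2))
      (fun n : ℕ => (1 + s + sqrt s * sqrt (1 + s)) ^ 2 /
        (2 * (2 * (Real.pi : ℂ) * (n : ℂ) * (sqrt s * sqrt (1 + s))) ^ (3 / 2 : ℂ)) *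
          (1 + 2 * s + 2 * (sqrt s * sqrt (1 + s))) ^ (2 * n)) := by
  obtain ⟨c, hc, hbd⟩ := norm_aperyPhase_le hs
  obtain ⟨-, -, hlim⟩ := tendsto_laplace (measurable_aperyPhase s) hc hbd (tendsto_aperyPhase hs)
  rw [cpow_half_eq hs] at hlim
  simp_rw [integral_aperyPhase_pow hs] at hlim
  have hq := re_sqrt_mul_sqrt_pos hs
  have hq0 := ne_zero_of_re_pos hq
  have hg0 : sqrt (sqrt s * sqrt (1 + s)) ≠ 0 := ne_zero_of_re_pos (re_sqrt_pos (Or.inl hq))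
  have hs1 : 1 + s ≠ 0 := slitPlane_ne_zero (mem_slitPlane_one_add hs)
  have hu0 := sqrt_add_sqrt_ne_zero s
  have hpi : (Real.pi : ℂ) ≠ 0 := ofReal_ne_zero.2 Real.pi_ne_zero
  have hr : ((√(2 * Real.pi) : ℝ) : ℂ) ^ 2 = 2 * Real.pi := by
    rw [← ofReal_pow, Real.sq_sqrt (by positivity)]
    push_cast
    ring
  have hr0 : ((√(2 * Real.pi) : ℝ) : ℂ) ≠ 0 :=
    ofReal_ne_zero.2 (Real.sqrt_pos.2 (by positivity)).ne'
  have hU : (sqrt s + sqrt (1 + s)) ^ 2 = 1 + 2 * s + 2 * (sqrt s * sqrt (1 + s)) := by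
    linear_combination sqrt_sq_self s + sqrt_sq_self (1 + s)
  -- `1 + s + √s √(1+s) = √(1+s) (√s + √(1+s))`.
  have hV : (1 + s + sqrt s * sqrt (1 + s)) ^ 2 = (1 + s) * (sqrt s + sqrt (1 + s)) ^ 2 := by
    linear_combination sqrt (1 + s) ^ 2 * sqrt_sq_self s - (1 + s) * sqrt_sq_self s -
      sqrt_sq_self (1 + s)
  rw [← hU, hV]
  simp_rw [cpow_three_halves_eq hq]
  rw [isEquivalent_iff_exists_eq_mul]
  set u := sqrt s + sqrt (1 + s)
  set q := sqrt s * sqrt (1 + s)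
  set r := ((√(2 * Real.pi) : ℝ) : ℂ)
  -- The multiplier is the reciprocal of the Laplace limit, written so that it also matches the
  -- claimed equivalent.
  refine ⟨_, (hlim.mul_const (2 * r ^ 3 * (q * sqrt q) / ((2 * (Real.pi : ℂ)) ^ 3 *
    ((1 + s) * u ^ 2)))).trans_eq ?_, ?_⟩
  · congr 1
    rw [← hr]
    field_simp
    linear_combination -hr
  · filter_upwards [eventually_ne_atTop 0] with n hn
    have hn0 : ((√(n : ℝ) : ℝ) : ℂ) ≠ 0 :=
      ofReal_ne_zero.2 (Real.sqrt_pos.2 (by positivity)).ne'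
    simp only [Pi.mul_apply]
    push_cast
    field_simp

theorem theorem4p1 :
    (∀ z : ℂ, z ∈ Complex.slitPlane →
      IsEquivalent atTop
        (fun n : ℕ => (aperyPolynomial n).eval z)
        (fun n : ℕ =>
          (1 + Complex.sqrt z + Complex.sqrt (z + Complex.sqrt z)) ^ 2 /
            (2 * (2 * (Real.pi : ℂ) * (n : ℂ) * Complex.sqrt (z + Complex.sqrt z))
              ^ (3 / 2 : ℂ)) *
            (1 + 2 * Complex.sqrt z + 2 * Complex.sqrt (z + Complex.sqrt z)) ^ (2 * n))) ∧
    IsEquivalent atTop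
      (fun n : ℕ => (aperyPolynomial n).eval 1)
      (fun n : ℕ =>
        (((1 + Real.sqrt 2) ^ 2 / (2 * Real.pi * Real.sqrt 2 * (n : ℝ)) ^ (3 / 2 : ℝ) *
          (1 + Real.sqrt 2) ^ (4 * n) : ℝ) : ℂ)) := by
  have main : ∀ z : ℂ, z ∈ Complex.slitPlane →
      IsEquivalent atTop
        (fun n : ℕ => (aperyPolynomial n).eval z)
        (fun n : ℕ =>
          (1 + Complex.sqrt z + Complex.sqrt (z + Complex.sqrt z)) ^ 2 /
            (2 * (2 * (Real.pi : ℂ) * (n : ℂ) * Complex.sqrt (z + Complex.sqrt z))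
              ^ (3 / 2 : ℂ)) *
            (1 + 2 * Complex.sqrt z + 2 * Complex.sqrt (z + Complex.sqrt z)) ^ (2 * n)) := by
    intro z hz
    have hs := re_sqrt_pos hz
    -- With `s = √z`, `z + √z = s(1 + s)`; positivity of the real part makes the product of roots
    -- principal.
    have hq : sqrt (z + sqrt z) = sqrt (sqrt z) * sqrt (1 + sqrt z) := by
      refine sqrt_eq_of_sq_eq ?_ (re_sqrt_mul_sqrt_pos hs)
      rw [mul_pow, sqrt_sq_self, sqrt_sq_self]
      linear_combination sqrt_sq_self z
    have h := isEquivalent_aperyPolynomial_sq hs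
    rw [sqrt_sq_self] at h
    rw [hq]
    exact h
  refine ⟨main, (main 1 one_mem_slitPlane).congr_right (Eventually.of_forall fun n => ?_)⟩
  have hsq : ((√2 : ℝ) : ℂ) ^ 2 = 2 := by
    rw [← ofReal_pow, Real.sq_sqrt two_pos.le]
    norm_num
  have h2 : sqrt (1 + 1) = ((√2 : ℝ) : ℂ) := by
    refine sqrt_eq_of_sq_eq (by rw [hsq]; norm_num) ?_
    rw [ofReal_re]
    positivity
  have hpow : (2 * (Real.pi : ℂ) * (n : ℂ) * ((√2 : ℝ) : ℂ)) ^ (3 / 2 : ℂ) =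
      (((2 * Real.pi * √2 * (n : ℝ)) ^ (3 / 2 : ℝ) : ℝ) : ℂ) := by
    rw [ofReal_cpow (by positivity)]
    congr 1 <;> push_cast <;> ring
  simp only [sqrt_one, h2, hpow]
  push_cast
  have e1 : (1 + 1 + ((√2 : ℝ) : ℂ)) ^ 2 = 2 * (1 + ((√2 : ℝ) : ℂ)) ^ 2 := by
    linear_combination -hsq
  have e2 : 1 + 2 * 1 + 2 * ((√2 : ℝ) : ℂ) = (1 + ((√2 : ℝ) : ℂ)) ^ 2 := by
    linear_combination -hsq
  rw [e1, e2, ← pow_mul, show 2 * (2 * n) = 4 * n by ring, mul_div_mul_left _ _ two_ne_zero]
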